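/- Let $d\in\{1,2\}$ and let $\Omega\subset\mathbb{R}^d$ be a bounded convex polygonal domain, i.e. a nonempty open convex set whose closure is the convex hull of finitely many points. For $f\in L^1(\Omega)$ put $$TV(f):=\sup\Big\{\int_\Omega f\,\mathrm{div}\rho\,\mathrm{d}x \;:\; \rho\in C_c^1(\Omega)^d,\ |\rho(x)|\le 1 \text{ for all } x\in\Omega\Big\},$$ where $|\cdot|$ is the Euclidean norm, and $BV(\Omega):=\{f\in L^1(\Omega): TV(f)<\infty\}$. Let $\{\mathcal{T}_h\}_{0<h<1}$ be a regular family of triangulations of $\Omega$ with mesh parameter $h$: each $\mathcal{T}_h$ is a finite conforming partition of $\overline\Omega$ into closed nondegenerate $d$-simplices (any two of which are disjoint or meet in a common face), every $K\in\mathcal{T}_h$ has diameter at most $h$, and there is a constant $\sigma$ independent of $h$ such that every $K\in\mathcal{T}_h$, $0<h<1$, contains a closed ball of diameter $\varrho>0$ with $\mathrm{diam}\,K\le\sigma\varrho$. Let $$X_h^1:=\{v_h\in C(\overline\Omega): v_h|_K \text{ is a polynomial of degree at most } 1 \text{ for every } K\in\mathcal{T}_h\}.$$ Then for every $1\le p<\infty$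 and every $f\in BV(\Omega)\cap L^p(\Omega)$ there are functions $\widehat f_h\in X_h^1$ ($0<h<1$) such that $$\lim_{h\to0}\|\widehat f_h-f\|_{L^p(\Omega)}=0\quad\text{and}\quad\lim_{h\to0}TV(\widehat f_h)=TV(f).$$ -/

import Mathlib

open Set Filter Topology MeasureTheory

/-- A (convex) polygonal domain in `ℝ^d`: a nonempty open convex set whose closure is the convex
hull of finitely many points. Such a set is bounded. -/
structure IsConvexPolygonalDomain {d : ℕ} (Ω : Set (EuclideanSpace ℝ (Fin d))) : Prop where
  isOpen : IsOpen Ω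
  nonempty : Ω.Nonempty
  convex : Convex ℝ Ω
  polygonal : ∃ S : Finset (EuclideanSpace ℝ (Fin d)), closure Ω = convexHull ℝ ↑S

/-- The divergence of a vector field on `ℝ^d`. -/
noncomputable def vecDiv {d : ℕ} (ρ : EuclideanSpace ℝ (Fin d) → EuclideanSpace ℝ (Fin d))
    (x : EuclideanSpace ℝ (Fin d)) : ℝ :=
  ∑ i : Fin d, (fderiv ℝ ρ x (EuclideanSpace.single i 1)) i

/-- The test fields for the total variation: `C^1` vector fields with compact support in `Ω`
(extended by zero) whose Euclidean norm is at most `1` everywhere. -/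
def tvTestFields {d : ℕ} (Ω : Set (EuclideanSpace ℝ (Fin d))) :
    Set (EuclideanSpace ℝ (Fin d) → EuclideanSpace ℝ (Fin d)) :=
  {ρ | ContDiff ℝ 1 ρ ∧ HasCompactSupport ρ ∧ tsupport ρ ⊆ Ω ∧ ∀ x, ‖ρ x‖ ≤ 1}

/-- The total variation of `f` on `Ω` (meaningful for `f ∈ L^1(Ω)`), with values in `[0, +∞]`. -/
noncomputable def totalVar {d : ℕ} (Ω : Set (EuclideanSpace ℝ (Fin d)))
    (f : EuclideanSpace ℝ (Fin d) → ℝ) : EReal :=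
  ⨆ ρ ∈ tvTestFields Ω, ((∫ x in Ω, f x * vecDiv ρ x : ℝ) : EReal)

/-- `f ∈ BV(Ω)`: `f ∈ L^1(Ω)` and its total variation is finite. -/
def IsBV {d : ℕ} (Ω : Set (EuclideanSpace ℝ (Fin d))) (f : EuclideanSpace ℝ (Fin d) → ℝ) : Prop :=
  IntegrableOn f Ω ∧ totalVar Ω f < ⊤

/-- The elements of a simplicial complex in `ℝ^d` (given by their vertex sets): its
`d`-dimensional simplices. -/
def meshElements {d : ℕ} (T : Geometry.SimplicialComplex ℝ (EuclideanSpace ℝ (Fin d))) :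
    Set (Finset (EuclideanSpace ℝ (Fin d))) :=
  {s | s ∈ T.faces ∧ s.card = d + 1}

/-- `T` is a (conforming, finite) triangulation of `Ω` into `d`-simplices. -/
structure IsTriangulation {d : ℕ} (Ω : Set (EuclideanSpace ℝ (Fin d)))
    (T : Geometry.SimplicialComplex ℝ (EuclideanSpace ℝ (Fin d))) : Prop where
  finite : T.faces.Finite
  pure : ∀ s ∈ T.faces, ∃ t ∈ meshElements T, s ⊆ t
  space_eq : T.space = closure Ω

/-- A regular family `(T h)`, `0 < h < 1`, of triangulations of `Ω` with mesh parameter `h`: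
the elements of `T h` have diameter at most `h`, and there is `σ`, the same for all `h`, such that
every element `K` contains a closed ball of positive diameter `2 r` with `diam K ≤ σ * (2 r)`. -/
structure IsRegularFamily {d : ℕ} (Ω : Set (EuclideanSpace ℝ (Fin d)))
    (T : ℝ → Geometry.SimplicialComplex ℝ (EuclideanSpace ℝ (Fin d))) : Prop where
  isTriangulation : ∀ h ∈ Ioo (0 : ℝ) 1, IsTriangulation Ω (T h)
  diam_le : ∀ h ∈ Ioo (0 : ℝ) 1, ∀ s ∈ meshElements (T h),
    Metric.diam (convexHull ℝ (s : Set (EuclideanSpace ℝ (Fin d)))) ≤ h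
  shape_regular : ∃ σ : ℝ, ∀ h ∈ Ioo (0 : ℝ) 1, ∀ s ∈ meshElements (T h),
    ∃ (x : EuclideanSpace ℝ (Fin d)) (r : ℝ), 0 < r ∧
      Metric.closedBall x r ⊆ convexHull ℝ (s : Set (EuclideanSpace ℝ (Fin d))) ∧
      Metric.diam (convexHull ℝ (s : Set (EuclideanSpace ℝ (Fin d)))) ≤ σ * (2 * r)

/-- The space of continuous piecewise linear finite element functions: functions continuous on
`closure Ω` that coincide on each element with a polynomial of degree at most one. Values outside
`closure Ω` are irrelevant. -/
def p1Space {d : ℕ} (Ω : Set (EuclideanSpace ℝ (Fin d)))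
    (T : Geometry.SimplicialComplex ℝ (EuclideanSpace ℝ (Fin d))) :
    Set (EuclideanSpace ℝ (Fin d) → ℝ) :=
  {v | ContinuousOn v (closure Ω) ∧ ∀ s ∈ meshElements T,
    ∃ a : EuclideanSpace ℝ (Fin d) →ᵃ[ℝ] ℝ,
      EqOn v a (convexHull ℝ (s : Set (EuclideanSpace ℝ (Fin d))))}

/-!
The total variation is lower semicontinuous with respect to convergence in `L^1(Ω)`
(`eventually_lt_totalVar`), so it suffices to find, for every `ε > 0` and all sufficiently small `h`,
a finite element function whose `L^p` distance from `f` is at most `ε` and whose total variation is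
at most `TV(f) + ε` (`eventually_exists_p1_approx`); a diagonal selection
(`exists_selection_of_eventually`) then gives the family.

Such functions are interpolants of a smooth approximation of `f`. Since `Ω` is convex, the
homotheties `x ↦ t x + (1 - t) z` with centre `z ∈ Ω` and ratio `t < 1` map `Ω` into itself.
Averaging `f` over them, with `z` distributed according to a smooth density supported in `Ω`, gives
a function which is smooth up to the boundary (`contDiff_homothetyAverage`), whose total variation
is at most `t ^ (1 - d) TV(f)` (`totalVar_homothetyAverage_le`), and which converges to `f` in `L^p`
as `t → 1` (`tendsto_eLpNorm_homothetyAverage_sub`). No extension or trace of `f` is involved.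

For a `C^2` function `u` with nodal interpolant `v`, the error `v - u` vanishes at the vertices, so
its gradient is small along the edges of each element, and the inscribed balls of a regular family
make the whole gradient of order `h` (`norm_linear_sub_fderiv_le`). As `closure Ω` is convex and
covered by finitely many elements, `v - u` is then Lipschitz with a constant of order `h`
(`lipschitzOnWith_of_subset_iUnion`), so that its total variation is of order `h`
(`totalVar_le_of_lipschitzOnWith`), and `TV(v) ≤ TV(u) + O(h)` by subadditivity.
-/

/-! ### Total variation -/

section TotalVariation

variable {d : ℕ} {Ω : Set (EuclideanSpace ℝ (Fin d))}
  {ρ : EuclideanSpace ℝ (Fin d) → EuclideanSpace ℝ (Fin d)}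
  {f g : EuclideanSpace ℝ (Fin d) → ℝ}

theorem continuous_vecDiv (hρ : ContDiff ℝ 1 ρ) : Continuous (vecDiv ρ) := by
  unfold vecDiv
  have h : Continuous (fderiv ℝ ρ) := hρ.continuous_fderiv (by norm_num)
  fun_prop

theorem vecDiv_eq_zero_of_notMem_tsupport {x : EuclideanSpace ℝ (Fin d)} (hx : x ∉ tsupport ρ) :
    vecDiv ρ x = 0 := by
  have h : fderiv ℝ ρ x = 0 := by
    by_contra h
    exact hx (support_fderiv_subset ℝ h)
  simp [vecDiv, h]

theorem hasCompactSupport_vecDiv (hρ : HasCompactSupport ρ) : HasCompactSupport (vecDiv ρ) :=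
  HasCompactSupport.of_support_subset_isCompact hρ fun x hx => by
    by_contra h
    exact hx (vecDiv_eq_zero_of_notMem_tsupport h)

theorem exists_abs_vecDiv_le (hρ : ρ ∈ tvTestFields Ω) : ∃ C : ℝ, ∀ x, |vecDiv ρ x| ≤ C :=
  (continuous_vecDiv hρ.1).bounded_above_of_compact_support (hasCompactSupport_vecDiv hρ.2.1)

theorem setIntegral_mul_vecDiv (hρ : ρ ∈ tvTestFields Ω) :
    ∫ x in Ω, f x * vecDiv ρ x = ∫ x, f x * vecDiv ρ x :=
  setIntegral_eq_integral_of_forall_compl_eq_zero fun x hx => by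
    rw [vecDiv_eq_zero_of_notMem_tsupport fun h => hx (hρ.2.2.1 h), mul_zero]

theorem integrable_mul_vecDiv {μ : Measure (EuclideanSpace ℝ (Fin d))} (hf : Integrable f μ)
    (hρ : ρ ∈ tvTestFields Ω) : Integrable (fun x => f x * vecDiv ρ x) μ := by
  obtain ⟨C, hC⟩ := exists_abs_vecDiv_le hρ
  exact hf.mul_bdd (c := C) (continuous_vecDiv hρ.1).aestronglyMeasurable (ae_of_all _ hC)

theorem totalVar_le_iff {c : EReal} :
    totalVar Ω f ≤ c ↔ ∀ ρ ∈ tvTestFields Ω, ((∫ x in Ω, f x * vecDiv ρ x : ℝ) : EReal) ≤ c :=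
  iSup₂_le_iff

theorem le_totalVar (hρ : ρ ∈ tvTestFields Ω) :
    ((∫ x in Ω, f x * vecDiv ρ x : ℝ) : EReal) ≤ totalVar Ω f :=
  le_iSup₂ (f := fun ρ (_ : ρ ∈ tvTestFields Ω) => ((∫ x in Ω, f x * vecDiv ρ x : ℝ) : EReal)) ρ hρ

theorem totalVar_nonneg : 0 ≤ totalVar Ω f := by
  have h0 : (0 : EuclideanSpace ℝ (Fin d) → EuclideanSpace ℝ (Fin d)) ∈ tvTestFields Ω :=
    ⟨contDiff_const, HasCompactSupport.zero, by simp [tsupport], by simp⟩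
  simpa [vecDiv] using le_totalVar (f := f) h0

theorem totalVar_congr_ae (h : f =ᵐ[volume.restrict Ω] g) : totalVar Ω f = totalVar Ω g := by
  unfold totalVar
  refine iSup_congr fun ρ => iSup_congr fun _ => ?_
  have h' : ∫ x in Ω, f x * vecDiv ρ x = ∫ x in Ω, g x * vecDiv ρ x :=
    integral_congr_ae (h.mono fun x hx => by simp only [hx])
  rw [h']

theorem totalVar_add_le {a b : ℝ} (hf : IntegrableOn f Ω) (hg : IntegrableOn g Ω)
    (hfa : totalVar Ω f ≤ a) (hgb : totalVar Ω g ≤ b) :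
    totalVar Ω (fun x => f x + g x) ≤ ((a + b : ℝ) : EReal) := by
  rw [totalVar_le_iff] at *
  intro ρ hρ
  have h1 := EReal.coe_le_coe_iff.1 (hfa ρ hρ)
  have h2 := EReal.coe_le_coe_iff.1 (hgb ρ hρ)
  rw [EReal.coe_le_coe_iff]
  simp only [add_mul]
  rw [integral_add (integrable_mul_vecDiv hf hρ) (integrable_mul_vecDiv hg hρ)]
  linarith

/-- Lower semicontinuity of the total variation under convergence in `L^1(Ω)`. -/
theorem eventually_lt_totalVar {ι : Type*} {l : Filter ι}
    {F : ι → EuclideanSpace ℝ (Fin d) → ℝ} {c : EReal}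
    (hf : IntegrableOn f Ω) (hF : ∀ᶠ i in l, IntegrableOn (F i) Ω)
    (hlim : Tendsto (fun i => eLpNorm (fun x => F i x - f x) 1 (volume.restrict Ω)) l (𝓝 0))
    (hc : c < totalVar Ω f) : ∀ᶠ i in l, c < totalVar Ω (F i) := by
  simp only [totalVar, lt_iSup_iff] at hc
  obtain ⟨ρ, hρ, hcρ⟩ := hc
  obtain ⟨C, hC⟩ := exists_abs_vecDiv_le hρ
  have hconv : Tendsto (fun i => ∫ x in Ω, F i x * vecDiv ρ x) l
      (𝓝 (∫ x in Ω, f x * vecDiv ρ x)) := by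
    refine tendsto_integral_of_L1 _ (integrable_mul_vecDiv hf hρ).aestronglyMeasurable
      (hF.mono fun i hi => integrable_mul_vecDiv hi hρ) ?_
    have h0 : Tendsto (fun i => ENNReal.ofReal C *
        eLpNorm (fun x => F i x - f x) 1 (volume.restrict Ω)) l (𝓝 0) := by
      simpa using ENNReal.Tendsto.const_mul hlim (Or.inr ENNReal.ofReal_ne_top)
    refine tendsto_of_tendsto_of_tendsto_of_le_of_le tendsto_const_nhds h0 (fun _ => zero_le)
      fun i => ?_
    dsimp only
    rw [eLpNorm_one_eq_lintegral_enorm, ← lintegral_const_mul' _ _ ENNReal.ofReal_ne_top]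
    refine lintegral_mono fun x => ?_
    rw [← sub_mul, enorm_mul, mul_comm]
    gcongr
    rw [← ofReal_norm]
    exact ENNReal.ofReal_le_ofReal (hC x)
  have hconv' := (continuous_coe_real_ereal.tendsto _).comp hconv
  filter_upwards [hconv'.eventually (lt_mem_nhds hcρ)] with i hi
  exact hi.trans_le (le_totalVar hρ)

/-- A Lipschitz function has finite total variation on a bounded set; the factor `d` comes from
treating the coordinates separately, and is not optimal. -/
theorem totalVar_le_of_lipschitzOnWith {L : NNReal} (hΩ : volume Ω ≠ ⊤) (hΩm : MeasurableSet Ω)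
    (hf : LipschitzOnWith L f Ω) :
    totalVar Ω f ≤ ((d * (L * volume.real Ω) : ℝ) : EReal) := by
  obtain ⟨W, hW, hWf⟩ := hf.extend_real
  rw [totalVar_le_iff]
  intro ρ hρ
  rw [EReal.coe_le_coe_iff]
  have hcongr : ∫ x in Ω, f x * vecDiv ρ x = ∫ x in Ω, W x * vecDiv ρ x :=
    setIntegral_congr_fun hΩm fun x hx => by simp only [hWf hx]
  rw [hcongr, setIntegral_mul_vecDiv hρ]
  have hdiff : Differentiable ℝ ρ := hρ.1.differentiable (by norm_num)
  have hρi : ∀ i, ContDiff ℝ 1 fun x => ρ x i := fun i => by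
    have := hρ.1
    fun_prop
  have hci : ∀ i, HasCompactSupport fun x => ρ x i := fun i =>
    hρ.2.1.comp_left (g := fun y : EuclideanSpace ℝ (Fin d) => y i) rfl
  have hline : ∀ i x, lineDeriv ℝ (fun x => ρ x i) x (-EuclideanSpace.single i 1) =
      -(fderiv ℝ ρ x (EuclideanSpace.single i 1)) i := by
    intro i x
    have hd : HasFDerivAt (fun x => ρ x i) ((EuclideanSpace.proj i).comp (fderiv ℝ ρ x)) x :=
      (EuclideanSpace.proj (𝕜 := ℝ) (ι := Fin d) i).hasFDerivAt.comp x
        (hdiff x).hasFDerivAt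
    rw [hd.differentiableAt.lineDeriv_eq_fderiv, hd.fderiv]
    simp
  have hfd : Continuous (fderiv ℝ ρ) := hρ.1.continuous_fderiv (by norm_num)
  have hint : ∀ i, Integrable fun x => W x * (fderiv ℝ ρ x (EuclideanSpace.single i 1)) i := by
    intro i
    refine Continuous.integrable_of_hasCompactSupport (by have := hW.continuous; fun_prop) ?_
    refine HasCompactSupport.of_support_subset_isCompact hρ.2.1 fun x hx => ?_
    by_contra h
    apply hx
    have h0 : fderiv ℝ ρ x = 0 := by
      by_contra h'
      exact h (support_fderiv_subset ℝ h')
    simp [h0]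
  have hparts : ∀ i, ∫ x, W x * (fderiv ℝ ρ x (EuclideanSpace.single i 1)) i =
      -∫ x, lineDeriv ℝ W x (EuclideanSpace.single i 1) * ρ x i := by
    intro i
    obtain ⟨D, hD⟩ := (hρi i).lipschitzWith_of_hasCompactSupport (hci i) (by norm_num)
    rw [hW.integral_lineDeriv_mul_eq hD (hci i), ← integral_neg]
    refine integral_congr_ae (ae_of_all _ fun x => ?_)
    simp only [hline]
    ring
  have hbound : ∀ i, ∫ x, W x * (fderiv ℝ ρ x (EuclideanSpace.single i 1)) i ≤
      L * volume.real Ω := by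
    intro i
    rw [hparts]
    have hset : ∫ x, lineDeriv ℝ W x (EuclideanSpace.single i 1) * ρ x i =
        ∫ x in Ω, lineDeriv ℝ W x (EuclideanSpace.single i 1) * ρ x i := by
      refine (setIntegral_eq_integral_of_forall_compl_eq_zero fun x hx => ?_).symm
      rw [image_eq_zero_of_notMem_tsupport fun h => hx (hρ.2.2.1 h)]
      simp
    rw [hset]
    refine (neg_le_abs _).trans ?_
    rw [← Real.norm_eq_abs]
    refine norm_setIntegral_le_of_norm_le_const hΩ.lt_top fun x _ => ?_
    rw [norm_mul]
    have h1 : ‖lineDeriv ℝ W x (EuclideanSpace.single i 1)‖ ≤ L := by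
      simpa using norm_lineDeriv_le_of_lipschitz (x₀ := x) (v := EuclideanSpace.single i (1 : ℝ))
        ℝ hW
    have h2 : ‖ρ x i‖ ≤ 1 := (PiLp.norm_apply_le (ρ x) i).trans (hρ.2.2.2 x)
    calc _ ≤ (L : ℝ) * 1 := by gcongr
      _ = L := mul_one _
  have hsum : ∫ x, W x * vecDiv ρ x =
      ∑ i, ∫ x, W x * (fderiv ℝ ρ x (EuclideanSpace.single i 1)) i := by
    rw [← integral_finsetSum _ fun i _ => hint i]
    simp only [vecDiv, Finset.mul_sum]
  rw [hsum]
  refine (Finset.sum_le_sum fun i _ => hbound i).trans ?_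
  simp

end TotalVariation

/-! ### Piecewise linear interpolation -/

section Interpolation

variable {E : Type*} [NormedAddCommGroup E] [NormedSpace ℝ E]

/-- Two affine functions that agree at points agree on their convex hull. -/
theorem AffineMap.eqOn_convexHull {a b : E →ᵃ[ℝ] ℝ} {s : Set E} (h : EqOn a b s) :
    EqOn a b (convexHull ℝ s) := by
  have hsub : convexHull ℝ s ⊆ (a - b) ⁻¹' {0} :=
    convexHull_min (fun x hx => by simp [h hx]) ((convex_singleton 0).affine_preimage (a - b))
  intro x hx
  have := hsub hx
  simpa [sub_eq_zero] using this

theorem exists_affineMap_eqOn [FiniteDimensional ℝ E] {s : Finset E}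
    (hs : AffineIndependent ℝ ((↑) : s → E)) (hcard : s.card = Module.finrank ℝ E + 1)
    (u : E → ℝ) : ∃ a : E →ᵃ[ℝ] ℝ, EqOn a u s := by
  classical
  let b : AffineBasis s ℝ E :=
    ⟨(↑), hs, by rw [hs.affineSpan_eq_top_iff_card_eq_finrank_add_one]; simpa using hcard⟩
  refine ⟨∑ i : s, u i • b.coord i, fun x hx => ?_⟩
  have hb : x = b ⟨x, hx⟩ := rfl
  have hval : ∀ i : s, b.coord i x = if i = ⟨x, hx⟩ then 1 else 0 := fun i => by
    conv_lhs => rw [hb]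
    rw [b.coord_apply]
  have hsum : (∑ i : s, u i • b.coord i) x = ∑ i : s, u i * b.coord i x := by
    induction (Finset.univ : Finset s) using Finset.induction_on with
    | empty => simp
    | insert i t hi ih => rw [Finset.sum_insert hi, Finset.sum_insert hi, ← ih]; simp
  rw [hsum]
  simp [hval]

/-- A functional whose values on the differences `y - v`, `y ∈ K`, are bounded by `B` has norm at
most `B / r` if `K` contains a ball of radius `r`. -/
theorem ContinuousLinearMap.opNorm_le_of_closedBall_subset {l : E →L[ℝ] ℝ} {K : Set E} {c v : E}
    {r B : ℝ} (hr : 0 < r) (hB : 0 ≤ B) (hball : Metric.closedBall c r ⊆ K)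
    (hl : ∀ y ∈ K, |l (y - v)| ≤ B) : ‖l‖ ≤ B / r := by
  refine ContinuousLinearMap.opNorm_le_of_unit_norm (by positivity) fun x hx => ?_
  have h1 := abs_le.1 (hl (c + r • x) (hball (by simp [norm_smul, hx, abs_of_pos hr])))
  have h2 := abs_le.1 (hl (c - r • x) (hball (by simp [norm_smul, hx, abs_of_pos hr])))
  simp only [map_sub, map_add, map_smul, smul_eq_mul] at h1 h2
  rw [Real.norm_eq_abs, abs_le, ← neg_div, div_le_iff₀ hr, le_div_iff₀ hr]
  constructor <;> linarith

/-- The gradient of the error of linear interpolation on a simplex: the difference of the gradients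
is small along the edges, since the error vanishes at the vertices, and an inscribed ball turns
this into a bound of the norm. -/
theorem norm_linear_sub_fderiv_le {u : E → ℝ} {M D r : ℝ} {s : Set E} {a : E →L[ℝ] ℝ} {b : ℝ}
    {c x : E} (hs : s.Nonempty) (hu : ∀ x ∈ convexHull ℝ s, DifferentiableAt ℝ u x)
    (hM : ∀ x ∈ convexHull ℝ s, ∀ y ∈ convexHull ℝ s, ‖fderiv ℝ u x - fderiv ℝ u y‖ ≤ M * dist x y)
    (hM0 : 0 ≤ M) (hD : ∀ x ∈ convexHull ℝ s, ∀ y ∈ convexHull ℝ s, dist x y ≤ D)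
    (ha : ∀ v ∈ s, a v + b = u v) (hr : 0 < r)
    (hball : Metric.closedBall c r ⊆ convexHull ℝ s) (hx : x ∈ convexHull ℝ s) :
    ‖a - fderiv ℝ u x‖ ≤ M * D * D / r := by
  obtain ⟨v, hv⟩ := hs
  have hv' := subset_convexHull ℝ s hv
  have hD0 : 0 ≤ D := dist_nonneg.trans (hD v hv' v hv')
  refine ContinuousLinearMap.opNorm_le_of_closedBall_subset (v := v) hr (by positivity) hball ?_
  have hconv : Convex ℝ {y | |(a - fderiv ℝ u x) (y - v)| ≤ M * D * D} := by
    have := (convex_closedBall (0 : ℝ) (M * D * D)).affine_preimage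
      ((a - fderiv ℝ u x).toLinearMap.toAffineMap.comp
        (AffineMap.id ℝ E - AffineMap.const ℝ E v))
    convert! this using 1
    ext y
    simp [sub_sub_sub_comm]
  refine convexHull_min (t := {y | |(a - fderiv ℝ u x) (y - v)| ≤ M * D * D}) (fun w hw => ?_) hconv
  have hw' := subset_convexHull ℝ s hw
  have hmv := (convex_convexHull ℝ s).norm_image_sub_le_of_norm_fderiv_le' (f := u)
    (φ := fderiv ℝ u x) (C := M * D) hu
    (fun y hy => (hM y hy x hx).trans (by gcongr; exact hD y hy x hx)) hv' hw'
  have heq : (a - fderiv ℝ u x) (w - v) = u w - u v - fderiv ℝ u x (w - v) := by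
    rw [← ha w hw, ← ha v hv]
    simp
  change |(a - fderiv ℝ u x) (w - v)| ≤ M * D * D
  rw [heq]
  refine hmv.trans ?_
  gcongr
  rw [← dist_eq_norm]
  exact hD w hw' v hv'

/-- Along a segment that is covered by finitely many closed sets, on each of which `w` is
`L`-Lipschitz, the increment of `w` is at most `L` times the length. -/
theorem sub_le_mul_dist_of_segment_subset_iUnion {ι : Type*} [Finite ι] {K : ι → Set E}
    {w : E → ℝ} {L : NNReal} {x y : E} (hK : ∀ i, IsClosed (K i))
    (hw : ∀ i, LipschitzOnWith L w (K i)) (hxy : segment ℝ x y ⊆ ⋃ i, K i) :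
    w y - w x ≤ L * dist x y := by
  set γ : ℝ → E := fun t => AffineMap.lineMap x y t with hγ
  have hγc : Continuous γ := AffineMap.lineMap_continuous
  have hγm : ∀ t ∈ Icc (0 : ℝ) 1, γ t ∈ ⋃ i, K i := fun t ht =>
    hxy (by rw [segment_eq_image_lineMap]; exact mem_image_of_mem _ ht)
  have hwc : ContinuousOn w (⋃ i, K i) :=
    (locallyFinite_of_finite K).continuousOn_iUnion hK fun i => (hw i).continuousOn
  have key := image_le_of_liminf_slope_right_le_deriv_boundary (f := fun t => w (γ t))
    (a := 0) (b := 1) (hwc.comp hγc.continuousOn hγm)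
    (B := fun t => w x + L * dist x y * t) (B' := fun _ => L * dist x y) (by simp [hγ])
    (by fun_prop)
    (fun t _ => by
      simpa using (((hasDerivAt_id t).const_mul (L * dist x y)).const_add (w x)).hasDerivWithinAt)
    ?_ (right_mem_Icc.2 zero_le_one)
  · simp only [hγ, AffineMap.lineMap_apply_one, mul_one] at key
    linarith
  intro t ht q hq
  -- By finiteness, one of the closed sets is visited at times decreasing to `t`.
  obtain ⟨i, hi⟩ : ∃ i, ∃ᶠ z in 𝓝[>] t, γ z ∈ K i := by
    by_contra! hcon
    have hcon' : ∀ i, ∀ᶠ z in 𝓝[>] t, γ z ∉ K i := hcon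
    have hev : ∀ᶠ z in 𝓝[>] t, z ∈ Icc (0 : ℝ) 1 := by
      filter_upwards [Ioo_mem_nhdsGT ht.2] with z hz
      exact ⟨ht.1.trans hz.1.le, hz.2.le⟩
    obtain ⟨z, hz, hz'⟩ := ((eventually_all.2 hcon').and hev).exists
    obtain ⟨i, hi⟩ := mem_iUnion.1 (hγm z hz')
    exact hz i hi
  have hti : γ t ∈ K i :=
    (hK i).mem_of_frequently_of_tendsto hi (hγc.continuousAt.tendsto.mono_left nhdsWithin_le_nhds)
  refine (hi.and_eventually self_mem_nhdsWithin).mono fun z hz => lt_of_le_of_lt ?_ hq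
  have hzt : 0 < z - t := sub_pos.2 hz.2
  have h1 := (hw i).dist_le_mul _ hz.1 _ hti
  rw [show dist (γ z) (γ t) = (z - t) * dist x y by
    rw [hγ, dist_lineMap_lineMap, Real.dist_eq, abs_of_pos hzt]] at h1
  rw [slope_def_field, div_le_iff₀ hzt]
  refine (le_abs_self _).trans (h1.trans_eq (by ring))

theorem lipschitzOnWith_of_subset_iUnion {ι : Type*} [Finite ι] {K : ι → Set E} {S : Set E}
    {w : E → ℝ} {L : NNReal} (hK : ∀ i, IsClosed (K i)) (hw : ∀ i, LipschitzOnWith L w (K i))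
    (hS : Convex ℝ S) (hSK : S ⊆ ⋃ i, K i) : LipschitzOnWith L w S := by
  refine LipschitzOnWith.of_dist_le_mul fun x hx y hy => ?_
  have h1 : w y - w x ≤ L * dist x y :=
    sub_le_mul_dist_of_segment_subset_iUnion hK hw ((hS.segment_subset hx hy).trans hSK)
  have h2 : w x - w y ≤ L * dist y x :=
    sub_le_mul_dist_of_segment_subset_iUnion hK hw ((hS.segment_subset hy hx).trans hSK)
  rw [dist_comm y x] at h2
  rw [Real.dist_eq, abs_le]
  constructor <;> linarith

end Interpolation

section Triangulation

variable {d : ℕ} {Ω : Set (EuclideanSpace ℝ (Fin d))}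

theorem IsConvexPolygonalDomain.isCompact_closure (hΩ : IsConvexPolygonalDomain Ω) :
    IsCompact (closure Ω) := by
  obtain ⟨S, hS⟩ := hΩ.polygonal
  rw [hS]
  exact S.finite_toSet.isCompact_convexHull ℝ

theorem IsTriangulation.closure_eq_iUnion
    {T : Geometry.SimplicialComplex ℝ (EuclideanSpace ℝ (Fin d))} (hT : IsTriangulation Ω T) :
    closure Ω = ⋃ s : meshElements T, convexHull ℝ (s.1 : Set (EuclideanSpace ℝ (Fin d))) := by
  rw [← hT.space_eq]
  refine Subset.antisymm (fun x hx => ?_)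
    (iUnion_subset fun s => T.convexHull_subset_space s.2.1)
  obtain ⟨s, hs, hxs⟩ := Geometry.SimplicialComplex.mem_space_iff.1 hx
  obtain ⟨t, ht, hst⟩ := hT.pure s hs
  exact mem_iUnion.2 ⟨⟨t, ht⟩, convexHull_mono (Finset.coe_subset.2 hst) hxs⟩

theorem IsTriangulation.finite_meshElements
    {T : Geometry.SimplicialComplex ℝ (EuclideanSpace ℝ (Fin d))} (hT : IsTriangulation Ω T) :
    Finite (meshElements T) :=
  (hT.finite.subset fun _ hs => hs.1).to_subtype

/-- Nodal interpolation: the affine interpolants on the elements glue to a continuous function because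
the triangulation is conforming. -/
theorem IsTriangulation.exists_interpolant
    {T : Geometry.SimplicialComplex ℝ (EuclideanSpace ℝ (Fin d))} (hT : IsTriangulation Ω T)
    (u : EuclideanSpace ℝ (Fin d) → ℝ) :
    ∃ v ∈ p1Space Ω T, ∀ s ∈ meshElements T, ∀ x ∈ s, v x = u x := by
  classical
  have hex : ∀ s : meshElements T, ∃ a : EuclideanSpace ℝ (Fin d) →ᵃ[ℝ] ℝ, EqOn a u s.1 :=
    fun s => exists_affineMap_eqOn (T.indep s.2.1) (by simpa using s.2.2) u
  choose a ha using hex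
  let v : EuclideanSpace ℝ (Fin d) → ℝ := fun x =>
    if hx : ∃ s : meshElements T, x ∈ convexHull ℝ (s.1 : Set (EuclideanSpace ℝ (Fin d)))
    then a hx.choose x else 0
  have hv : ∀ s : meshElements T,
      EqOn v (a s) (convexHull ℝ (s.1 : Set (EuclideanSpace ℝ (Fin d)))) := by
    intro s x hx
    have hex : ∃ s : meshElements T, x ∈ convexHull ℝ (s.1 : Set (EuclideanSpace ℝ (Fin d))) :=
      ⟨s, hx⟩
    have hvx : v x = a hex.choose x := dif_pos hex
    rw [hvx]
    -- The two elements meet in the hull of their common vertices, where the affine pieces agree.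
    have hinter := T.inter_subset_convexHull hex.choose.2.1 s.2.1 ⟨hex.choose_spec, hx⟩
    exact AffineMap.eqOn_convexHull (fun y hy => (ha _ hy.1).trans (ha s hy.2).symm) hinter
  have := hT.finite_meshElements
  refine ⟨v, ⟨?_, fun s hs => ⟨a ⟨s, hs⟩, hv ⟨s, hs⟩⟩⟩, fun s hs x hx => ?_⟩
  · rw [hT.closure_eq_iUnion]
    exact (locallyFinite_of_finite _).continuousOn_iUnion
      (fun s => s.1.finite_toSet.isClosed_convexHull ℝ)
      fun s => (a s).continuous_of_finiteDimensional.continuousOn.congr (hv s)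
  · rw [hv ⟨s, hs⟩ (subset_convexHull ℝ _ hx), ha ⟨s, hs⟩ hx]

/-- Error estimate for the interpolation of a `C^2` function on a regular family of triangulations:
the error is of order `h` in the Lipschitz seminorm and in the supremum norm. -/
theorem IsRegularFamily.exists_interpolant_error_le
    {T : ℝ → Geometry.SimplicialComplex ℝ (EuclideanSpace ℝ (Fin d))}
    (hΩ : IsConvexPolygonalDomain Ω) (hT : IsRegularFamily Ω T)
    {u : EuclideanSpace ℝ (Fin d) → ℝ} (hu : ContDiff ℝ 2 u) :
    ∃ C : NNReal, ∀ h ∈ Ioo (0 : ℝ) 1, ∃ v ∈ p1Space Ω (T h),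
      LipschitzOnWith (C * h.toNNReal) (fun x => v x - u x) (closure Ω) ∧
      ∀ x ∈ closure Ω, |v x - u x| ≤ C * h := by
  have hud : Differentiable ℝ u := hu.differentiable (by norm_num)
  have hu' : ContDiff ℝ 1 (fderiv ℝ u) := hu.fderiv_right (by norm_num)
  obtain ⟨M, hM⟩ := hΩ.isCompact_closure.exists_bound_of_continuousOn
    (hu'.continuous_fderiv (by norm_num)).continuousOn
  have hM0 : 0 ≤ M := by
    obtain ⟨x, hx⟩ := hΩ.nonempty
    exact (norm_nonneg _).trans (hM x (subset_closure hx))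
  have hML : ∀ x ∈ closure Ω, ∀ y ∈ closure Ω, ‖fderiv ℝ u x - fderiv ℝ u y‖ ≤ M * dist x y := by
    intro x hx y hy
    rw [dist_eq_norm]
    exact hΩ.convex.closure.norm_image_sub_le_of_norm_fderiv_le
      (fun z _ => hu'.differentiable (by norm_num) z) hM hy hx
  obtain ⟨σ, hσ⟩ := hT.shape_regular
  obtain ⟨C, hC⟩ : ∃ C : NNReal, (C : ℝ) = M * (2 * |σ|) := ⟨⟨_, by positivity⟩, rfl⟩
  refine ⟨C, fun h hh => ?_⟩
  have hTh := hT.isTriangulation h hh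
  obtain ⟨v, hv, hvu⟩ := hTh.exists_interpolant u
  have hsub : ∀ s ∈ meshElements (T h),
      convexHull ℝ (s : Set (EuclideanSpace ℝ (Fin d))) ⊆ closure Ω := fun s hs => by
    rw [← hTh.space_eq]
    exact (T h).convexHull_subset_space hs.1
  have hdist : ∀ s ∈ meshElements (T h), ∀ x ∈ convexHull ℝ (s : Set (EuclideanSpace ℝ (Fin d))),
      ∀ y ∈ convexHull ℝ (s : Set (EuclideanSpace ℝ (Fin d))),
      dist x y ≤ Metric.diam (convexHull ℝ (s : Set (EuclideanSpace ℝ (Fin d)))) :=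
    fun s _ x hx y hy =>
      Metric.dist_le_diam_of_mem (s.finite_toSet.isCompact_convexHull ℝ).isBounded hx hy
  have hpiece : ∀ s ∈ meshElements (T h),
      LipschitzOnWith (C * h.toNNReal) (fun x => v x - u x)
        (convexHull ℝ (s : Set (EuclideanSpace ℝ (Fin d)))) := by
    intro s hs
    obtain ⟨a, ha⟩ := hv.2 s hs
    obtain ⟨c, r, hr, hball, hreg⟩ := hσ h hh s hs
    set D := Metric.diam (convexHull ℝ (s : Set (EuclideanSpace ℝ (Fin d)))) with hD
    have hD0 : 0 ≤ D := Metric.diam_nonneg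
    have hDh : D ≤ h := hT.diam_le h hh s hs
    set A := LinearMap.toContinuousLinearMap a.linear with hA
    have haA : ∀ x, a x = A x + a 0 := fun x => by
      simpa [hA] using congrFun a.decomp x
    have hlip : LipschitzOnWith (C * h.toNNReal)
        (fun x => (A x + a 0) - u x) (convexHull ℝ (s : Set (EuclideanSpace ℝ (Fin d)))) := by
      have hderiv : ∀ x, HasFDerivAt (fun x => (A x + a 0) - u x) (A - fderiv ℝ u x) x :=
        fun x => (A.hasFDerivAt.add_const _).sub (hud x).hasFDerivAt
      refine (convex_convexHull ℝ _).lipschitzOnWith_of_nnnorm_hasFDerivWithin_le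
        (fun x _ => (hderiv x).hasFDerivWithinAt) fun x hx => ?_
      have hest := norm_linear_sub_fderiv_le (a := A) (b := a 0)
        (Finset.coe_nonempty.2 (Geometry.SimplicialComplex.nonempty_of_mem_faces hs.1))
        (fun y _ => hud y)
        (fun y hy z hz => hML y (hsub s hs hy) z (hsub s hs hz)) hM0 (hdist s hs)
        (fun w hw => by
          rw [← haA, ← ha (subset_convexHull ℝ _ hw), hvu s hs w hw]) hr hball hx
      rw [← NNReal.coe_le_coe]
      refine hest.trans ?_
      rw [← hD, NNReal.coe_mul, Real.coe_toNNReal _ hh.1.le, hC, div_le_iff₀ hr]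
      calc M * D * D ≤ M * h * (|σ| * (2 * r)) := by
            have hM' : 0 ≤ M * h := mul_nonneg hM0 hh.1.le
            gcongr
            exact hreg.trans (by gcongr; exact le_abs_self σ)
        _ = M * (2 * |σ|) * h * r := by ring
    refine LipschitzOnWith.of_dist_le_mul fun x hx y hy => ?_
    rw [ha hx, ha hy, haA x, haA y]
    exact hlip.dist_le_mul x hx y hy
  have := hTh.finite_meshElements
  refine ⟨v, hv, lipschitzOnWith_of_subset_iUnion
    (fun s : meshElements (T h) => s.1.finite_toSet.isClosed_convexHull ℝ)
    (fun s => hpiece s.1 s.2) hΩ.convex.closure hTh.closure_eq_iUnion.subset, fun x hx => ?_⟩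
  rw [hTh.closure_eq_iUnion] at hx
  obtain ⟨⟨s, hs⟩, hxs⟩ := mem_iUnion.1 hx
  obtain ⟨y, hy⟩ := Geometry.SimplicialComplex.nonempty_of_mem_faces hs.1
  have hy' := subset_convexHull ℝ (s : Set (EuclideanSpace ℝ (Fin d))) hy
  have h1 := (hpiece s hs).dist_le_mul x hxs y hy'
  simp only [hvu s hs y hy, sub_self, Real.dist_eq, sub_zero] at h1
  refine h1.trans ?_
  rw [NNReal.coe_mul, Real.coe_toNNReal _ hh.1.le]
  refine mul_le_of_le_one_right (mul_nonneg (NNReal.coe_nonneg _) hh.1.le) ?_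
  exact (hdist s hs x hxs y hy').trans ((hT.diam_le h hh s hs).trans hh.2.le)

end Triangulation

/-! ### Averages over homotheties -/

section HomothetyAverage

variable {d : ℕ} {Ω : Set (EuclideanSpace ℝ (Fin d))}
  {ν : Measure (EuclideanSpace ℝ (Fin d))} {t : ℝ} {p : ENNReal}

/-- The average of `g` over the homotheties `x ↦ t • x + (1 - t) • z` with centre `z` distributed
according to `ν`. If `ν` is concentrated on a convex set, these maps preserve that set, so no
extension of `g` is needed; if `ν` has a smooth density, the average is smooth. -/
noncomputable def homothetyAverage (ν : Measure (EuclideanSpace ℝ (Fin d))) (t : ℝ)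
    (g : EuclideanSpace ℝ (Fin d) → ℝ) (x : EuclideanSpace ℝ (Fin d)) : ℝ :=
  ∫ z, g (t • x + (1 - t) • z) ∂ν

theorem integral_comp_smul_add (F : EuclideanSpace ℝ (Fin d) → ℝ) (ht : 0 < t)
    (c : EuclideanSpace ℝ (Fin d)) :
    ∫ x, F (t • x + c) = (t ^ d)⁻¹ * ∫ x, F x := by
  rw [Measure.integral_comp_smul volume (fun y => F (y + c)) t, integral_add_right_eq_self]
  simp [abs_of_pos ht]

theorem lintegral_comp_smul_add {F : EuclideanSpace ℝ (Fin d) → ENNReal} (hF : Measurable F)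
    (ht : 0 < t) (c : EuclideanSpace ℝ (Fin d)) :
    ∫⁻ x, F (t • x + c) = ENNReal.ofReal (t ^ d)⁻¹ * ∫⁻ x, F x := by
  rw [← lintegral_map (μ := volume) (f := fun y => F (y + c)) (g := fun x => t • x)
      (hF.comp (measurable_add_const c)) (measurable_const_smul t),
    Measure.map_addHaar_smul volume ht.ne', lintegral_smul_measure, lintegral_add_right_eq_self]
  simp [abs_of_pos ht]

theorem measurable_comp_homothety {g : EuclideanSpace ℝ (Fin d) → ℝ} (hg : Measurable g) :
    Measurable fun q : EuclideanSpace ℝ (Fin d) × EuclideanSpace ℝ (Fin d) =>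
      g (t • q.1 + (1 - t) • q.2) :=
  hg.comp (by fun_prop)

theorem integrable_comp_homothety [IsProbabilityMeasure ν] {g : EuclideanSpace ℝ (Fin d) → ℝ}
    (hgm : Measurable g) (hg : Integrable g) (ht : 0 < t) :
    Integrable (fun q : EuclideanSpace ℝ (Fin d) × EuclideanSpace ℝ (Fin d) =>
      g (t • q.1 + (1 - t) • q.2)) (volume.prod ν) := by
  refine ⟨(measurable_comp_homothety hgm).aestronglyMeasurable, ?_⟩
  rw [hasFiniteIntegral_iff_enorm,
    lintegral_prod_symm _ (measurable_comp_homothety hgm).enorm.aemeasurable]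
  simp only [lintegral_comp_smul_add (F := fun x => ‖g x‖ₑ) hgm.enorm ht]
  rw [lintegral_const, measure_univ, mul_one]
  exact ENNReal.mul_lt_top ENNReal.ofReal_lt_top hg.2

theorem stronglyMeasurable_homothetyAverage [IsProbabilityMeasure ν]
    {g : EuclideanSpace ℝ (Fin d) → ℝ} (hg : Measurable g) :
    StronglyMeasurable (homothetyAverage ν t g) :=
  (measurable_comp_homothety hg).stronglyMeasurable.integral_prod_right

theorem vecDiv_comp_homothety {ρ : EuclideanSpace ℝ (Fin d) → EuclideanSpace ℝ (Fin d)}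
    (hρ : Differentiable ℝ ρ) (c x : EuclideanSpace ℝ (Fin d)) :
    vecDiv (fun w => ρ (t⁻¹ • (w - c))) x = t⁻¹ * vecDiv ρ (t⁻¹ • (x - c)) := by
  have h1 : HasFDerivAt (fun w : EuclideanSpace ℝ (Fin d) => t⁻¹ • (w - c))
      (t⁻¹ • ContinuousLinearMap.id ℝ (EuclideanSpace ℝ (Fin d))) x :=
    ((hasFDerivAt_id x).sub_const c).const_smul t⁻¹
  have h2 := (hρ (t⁻¹ • (x - c))).hasFDerivAt.comp x h1
  have h3 : fderiv ℝ (fun w => ρ (t⁻¹ • (w - c))) x = _ := h2.fderiv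
  simp [vecDiv, h3, Finset.mul_sum]

/-- Test fields on a convex set are preserved by composition with the inverse of a contracting
homothety centred in the set. -/
theorem comp_homothety_mem_tvTestFields
    {ρ : EuclideanSpace ℝ (Fin d) → EuclideanSpace ℝ (Fin d)} (hΩ : Convex ℝ Ω)
    (hρ : ρ ∈ tvTestFields Ω) (ht : t ∈ Ioo (0 : ℝ) 1) {z : EuclideanSpace ℝ (Fin d)}
    (hz : z ∈ Ω) : (fun w => ρ (t⁻¹ • (w - (1 - t) • z))) ∈ tvTestFields Ω := by
  have ht0 : t ≠ 0 := ht.1.ne'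
  let e : EuclideanSpace ℝ (Fin d) ≃ₜ EuclideanSpace ℝ (Fin d) :=
    { toFun := fun w => t⁻¹ • (w - (1 - t) • z)
      invFun := fun x => t • x + (1 - t) • z
      left_inv := fun w => by simp [smul_smul, ht0]
      right_inv := fun x => by simp [smul_smul, ht0]
      continuous_toFun := by fun_prop
      continuous_invFun := by fun_prop }
  refine ⟨?_, hρ.2.1.comp_homeomorph e, fun w hw => ?_, fun x => hρ.2.2.2 _⟩
  · have := hρ.1
    fun_prop
  · have hw' : w ∈ tsupport (ρ ∘ e) := hw
    rw [tsupport_comp_eq_preimage ρ e] at hw'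
    have hmem : e w ∈ Ω := hρ.2.2.1 hw'
    have heq : w = t • e w + (1 - t) • z := (e.left_inv w).symm
    rw [heq]
    exact hΩ hmem hz ht.1.le (by linarith [ht.2]) (by ring)

/-- Averaging over homotheties increases the total variation at most by the factor `t ^ (1 - d)`,
the one by which a homothety of ratio `t` changes it. -/
theorem totalVar_homothetyAverage_le [IsProbabilityMeasure ν]
    {g : EuclideanSpace ℝ (Fin d) → ℝ} (hΩ : Convex ℝ Ω) (hν : ∀ᵐ z ∂ν, z ∈ Ω)
    (hgm : Measurable g) (hg : Integrable g) (ht : t ∈ Ioo (0 : ℝ) 1) {V : ℝ}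
    (hV : totalVar Ω g ≤ V) :
    totalVar Ω (homothetyAverage ν t g) ≤ (((t ^ d)⁻¹ * t * V : ℝ) : EReal) := by
  rw [totalVar_le_iff] at hV ⊢
  intro ρ hρ
  have ht0 : t ≠ 0 := ht.1.ne'
  rw [EReal.coe_le_coe_iff, setIntegral_mul_vecDiv hρ]
  have hint : Integrable (fun q : EuclideanSpace ℝ (Fin d) × EuclideanSpace ℝ (Fin d) =>
      g (t • q.1 + (1 - t) • q.2) * vecDiv ρ q.1) (volume.prod ν) := by
    obtain ⟨C, hC⟩ := exists_abs_vecDiv_le hρ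
    exact (integrable_comp_homothety hgm hg ht.1).mul_bdd (c := C)
      ((continuous_vecDiv hρ.1).comp continuous_fst).aestronglyMeasurable
      (ae_of_all _ fun q => hC q.1)
  have hinner : ∀ z ∈ Ω, ∫ x, g (t • x + (1 - t) • z) * vecDiv ρ x ≤ (t ^ d)⁻¹ * t * V := by
    intro z hz
    have hρz := comp_homothety_mem_tvTestFields hΩ hρ ht hz
    have hdiv : ∀ x, vecDiv ρ x =
        t * vecDiv (fun w => ρ (t⁻¹ • (w - (1 - t) • z))) (t • x + (1 - t) • z) := by
      intro x
      rw [vecDiv_comp_homothety (hρ.1.differentiable (by norm_num))]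
      simp [smul_smul, ht0]
    have hbound := EReal.coe_le_coe_iff.1 (hV _ hρz)
    rw [setIntegral_mul_vecDiv hρz] at hbound
    simp only [hdiv]
    rw [integral_comp_smul_add (fun y => g y *
      (t * vecDiv (fun w => ρ (t⁻¹ • (w - (1 - t) • z))) y)) ht.1]
    simp only [mul_left_comm _ t]
    rw [integral_const_mul, ← mul_assoc]
    have := ht.1
    gcongr
  calc ∫ x, homothetyAverage ν t g x * vecDiv ρ x
      = ∫ x, ∫ z, g (t • x + (1 - t) • z) * vecDiv ρ x ∂ν := by
        simp only [homothetyAverage, integral_mul_const]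
    _ = ∫ z, (∫ x, g (t • x + (1 - t) • z) * vecDiv ρ x) ∂ν := integral_integral_swap hint
    _ ≤ ∫ _, (t ^ d)⁻¹ * t * V ∂ν :=
        integral_mono_ae hint.integral_prod_right (integrable_const _)
          (hν.mono fun z hz => hinner z hz)
    _ = (t ^ d)⁻¹ * t * V := by simp

/-- Smoothness of the average, which is a rescaled convolution if `ν` has a smooth density. -/
theorem contDiff_homothetyAverage {φ g : EuclideanSpace ℝ (Fin d) → ℝ} (hφ : ContDiff ℝ 2 φ)
    (hφc : HasCompactSupport φ) (hφ0 : ∀ x, 0 ≤ φ x) (hg : Integrable g)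
    (ht : t ∈ Ioo (0 : ℝ) 1) :
    ContDiff ℝ 2
      (homothetyAverage (volume.withDensity fun x => ENNReal.ofReal (φ x)) t g) := by
  have hs : 0 < 1 - t := sub_pos.2 ht.2
  set ψ : EuclideanSpace ℝ (Fin d) → ℝ := fun v => φ (-((1 - t)⁻¹ • v)) with hψ
  have hψ2 : ContDiff ℝ 2 ψ := by fun_prop
  have hψc : HasCompactSupport ψ :=
    (hφc.comp_homeomorph (Homeomorph.neg _)).comp_homeomorph
      (Homeomorph.smulOfNeZero (1 - t)⁻¹ (inv_ne_zero hs.ne'))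
  have hconv := hψc.contDiff_convolution_right (ContinuousLinearMap.mul ℝ ℝ) (μ := volume)
    hg.locallyIntegrable (n := 2) hψ2
  have heq : homothetyAverage (volume.withDensity fun x => ENNReal.ofReal (φ x)) t g =
      fun x => ((1 - t) ^ d)⁻¹ *
        convolution g ψ (ContinuousLinearMap.mul ℝ ℝ) volume (t • x) := by
    ext x
    have hmeas : Measurable fun x => ENNReal.ofReal (φ x) :=
      hφ.continuous.measurable.ennreal_ofReal
    rw [homothetyAverage, integral_withDensity_eq_integral_toReal_smul hmeas (by simp)]
    simp only [convolution, ContinuousLinearMap.mul_apply']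
    rw [← integral_comp_smul_add _ hs (t • x)]
    refine integral_congr_ae (ae_of_all _ fun z => ?_)
    simp only [hψ, ENNReal.toReal_ofReal (hφ0 z), smul_eq_mul]
    rw [show t • x - ((1 - t) • z + t • x) = -((1 - t) • z) by abel, smul_neg, neg_neg,
      smul_smul, inv_mul_cancel₀ hs.ne', one_smul, add_comm, mul_comm]
  rw [heq]
  exact contDiff_const.mul (hconv.comp (contDiff_const_smul t))

/-- Jensen's inequality for the average, integrated over the whole space. -/
theorem eLpNorm_homothetyAverage_le [IsProbabilityMeasure ν]
    {g : EuclideanSpace ℝ (Fin d) → ℝ} (hgm : Measurable g) (hp : 1 ≤ p) (hp_top : p ≠ ⊤)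
    (ht : t ∈ Ioo (1 / 2 : ℝ) 1) :
    eLpNorm (homothetyAverage ν t g) p volume ≤
      (2 ^ d) ^ (1 / p.toReal) * eLpNorm g p volume := by
  have ht0 : 0 < t := lt_trans (by norm_num) ht.1
  have hp0 : p ≠ 0 := (zero_lt_one.trans_le hp).ne'
  have hpr : 0 < p.toReal := ENNReal.toReal_pos hp0 hp_top
  have hmeas : Measurable fun q : EuclideanSpace ℝ (Fin d) × EuclideanSpace ℝ (Fin d) =>
      ‖g (t • q.1 + (1 - t) • q.2)‖ₑ ^ p.toReal :=
    (measurable_comp_homothety hgm).enorm.pow_const _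
  have hpt : ∀ x, ‖homothetyAverage ν t g x‖ₑ ^ p.toReal ≤
      ∫⁻ z, ‖g (t • x + (1 - t) • z)‖ₑ ^ p.toReal ∂ν := by
    intro x
    have hmx : Measurable fun z => g (t • x + (1 - t) • z) := hgm.comp (by fun_prop)
    have h1 : ‖homothetyAverage ν t g x‖ₑ ≤ eLpNorm (fun z => g (t • x + (1 - t) • z)) p ν := by
      refine (enorm_integral_le_lintegral_enorm _).trans ?_
      rw [← eLpNorm_one_eq_lintegral_enorm]
      exact eLpNorm_le_eLpNorm_of_exponent_le hp hmx.aestronglyMeasurable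
    rw [eLpNorm_eq_lintegral_rpow_enorm_toReal hp0 hp_top] at h1
    calc _ ≤ ((∫⁻ z, ‖g (t • x + (1 - t) • z)‖ₑ ^ p.toReal ∂ν) ^ (1 / p.toReal)) ^ p.toReal := by
          gcongr
      _ = _ := by rw [← ENNReal.rpow_mul, one_div_mul_cancel hpr.ne', ENNReal.rpow_one]
  rw [eLpNorm_eq_lintegral_rpow_enorm_toReal hp0 hp_top,
    eLpNorm_eq_lintegral_rpow_enorm_toReal hp0 hp_top,
    ← ENNReal.mul_rpow_of_nonneg _ _ (by positivity)]
  gcongr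
  calc ∫⁻ x, ‖homothetyAverage ν t g x‖ₑ ^ p.toReal
      ≤ ∫⁻ x, ∫⁻ z, ‖g (t • x + (1 - t) • z)‖ₑ ^ p.toReal ∂ν := lintegral_mono hpt
    _ = ∫⁻ z, (∫⁻ x, ‖g (t • x + (1 - t) • z)‖ₑ ^ p.toReal) ∂ν :=
        lintegral_lintegral_swap hmeas.aemeasurable
    _ = ENNReal.ofReal (t ^ d)⁻¹ * ∫⁻ x, ‖g x‖ₑ ^ p.toReal := by
        simp only [lintegral_comp_smul_add (F := fun x => ‖g x‖ₑ ^ p.toReal)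
          (hgm.enorm.pow_const _) ht0]
        rw [lintegral_const, measure_univ, mul_one]
    _ ≤ 2 ^ d * ∫⁻ x, ‖g x‖ₑ ^ p.toReal := by
        gcongr
        rw [← inv_pow, ENNReal.ofReal_pow (by positivity)]
        gcongr
        rw [← ENNReal.ofReal_ofNat 2]
        refine ENNReal.ofReal_le_ofReal ?_
        rw [inv_le_comm₀ ht0 (by norm_num)]
        linarith [ht.1]

/-- On a bounded set, the averages of a uniformly continuous function converge uniformly. -/
theorem eventually_abs_homothetyAverage_sub_le [IsProbabilityMeasure ν]
    {g : EuclideanSpace ℝ (Fin d) → ℝ} (hgc : Continuous g) (hgs : HasCompactSupport g)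
    (hΩ : Bornology.IsBounded Ω) (hν : ∀ᵐ z ∂ν, z ∈ Ω) {η : ℝ} (hη : 0 < η) :
    ∀ᶠ t in 𝓝[<] (1 : ℝ), ∀ x ∈ Ω, |homothetyAverage ν t g x - g x| ≤ η := by
  obtain ⟨r, hr, hgr⟩ := Metric.uniformContinuous_iff.1
    (hgs.uniformContinuous_of_continuous hgc) η hη
  obtain ⟨B, hB⟩ := hgc.bounded_above_of_compact_support hgs
  have hsmall : ∀ᶠ t in 𝓝[<] (1 : ℝ), (1 - t) * Metric.diam Ω < r := by
    have hcont : ContinuousAt (fun t : ℝ => (1 - t) * Metric.diam Ω) 1 := by fun_prop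
    have : Tendsto (fun t : ℝ => (1 - t) * Metric.diam Ω) (𝓝 1) (𝓝 0) := by
      simpa using hcont.tendsto
    exact (this.mono_left nhdsWithin_le_nhds).eventually (gt_mem_nhds hr)
  filter_upwards [hsmall, self_mem_nhdsWithin] with t htr ht x hx
  have ht1 : 0 < 1 - t := sub_pos.2 ht
  have hint : Integrable (fun z => g (t • x + (1 - t) • z)) ν :=
    Integrable.of_bound (Continuous.aestronglyMeasurable (by fun_prop)) B
      (ae_of_all _ fun z => hB _)
  have heq : homothetyAverage ν t g x - g x = ∫ z, (g (t • x + (1 - t) • z) - g x) ∂ν := by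
    rw [integral_sub hint (integrable_const _)]
    simp [homothetyAverage]
  rw [heq, ← Real.norm_eq_abs]
  have hle := norm_integral_le_of_norm_le_const (μ := ν) (C := η)
    (f := fun z => g (t • x + (1 - t) • z) - g x) (hν.mono fun z hz => ?_)
  · simpa using hle
  · rw [← dist_eq_norm]
    refine (hgr ?_).le
    refine lt_of_le_of_lt ?_ htr
    rw [dist_eq_norm, show t • x + (1 - t) • z - x = (1 - t) • (z - x) by module, norm_smul,
      Real.norm_eq_abs, abs_of_pos ht1, ← dist_eq_norm]
    gcongr
    exact Metric.dist_le_diam_of_mem hΩ hz hx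

theorem tendsto_eLpNorm_homothetyAverage_sub [IsProbabilityMeasure ν]
    {g : EuclideanSpace ℝ (Fin d) → ℝ} (hgm : Measurable g) (hg : Integrable g)
    (hgp : MemLp g p volume) (hp : 1 ≤ p) (hp_top : p ≠ ⊤) (hΩm : MeasurableSet Ω)
    (hΩ : Bornology.IsBounded Ω) (hν : ∀ᵐ z ∂ν, z ∈ Ω) :
    Tendsto (fun t => eLpNorm (fun x => homothetyAverage ν t g x - g x) p (volume.restrict Ω))
      (𝓝[<] (1 : ℝ)) (𝓝 0) := by
  set C : ENNReal := (2 ^ d) ^ (1 / p.toReal) with hC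
  have hCtop : C ≠ ⊤ := ENNReal.rpow_ne_top_of_nonneg (by positivity) (by finiteness)
  have main : ∀ δ : ENNReal, δ ≠ 0 → ∀ᶠ t in 𝓝[<] (1 : ℝ),
      eLpNorm (fun x => homothetyAverage ν t g x - g x) p (volume.restrict Ω) ≤
        (C + 2) * δ := by
    intro δ hδ
    obtain ⟨k, hks, hkδ, hkc, hkp⟩ := hgp.exists_hasCompactSupport_eLpNorm_sub_le hp_top hδ
    have hki : Integrable k := hkc.integrable_of_hasCompactSupport hks
    obtain ⟨η, hη, hηδ⟩ : ∃ η : ℝ, 0 < η ∧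
        volume.restrict Ω univ ^ p.toReal⁻¹ * ENNReal.ofReal η ≤ δ := by
      have hvol : volume.restrict Ω univ ^ p.toReal⁻¹ ≠ ⊤ := by
        rw [Measure.restrict_apply_univ]
        exact ENNReal.rpow_ne_top_of_nonneg (by positivity) hΩ.measure_lt_top.ne
      have hlim : Tendsto (fun η : ℝ => volume.restrict Ω univ ^ p.toReal⁻¹ * ENNReal.ofReal η)
          (𝓝[>] 0) (𝓝 0) := by
        have h0 : Tendsto (fun η : ℝ => ENNReal.ofReal η) (𝓝[>] 0) (𝓝 0) := by
          simpa using (ENNReal.continuous_ofReal.tendsto 0).mono_left nhdsWithin_le_nhds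
        simpa using ENNReal.Tendsto.const_mul h0 (Or.inr hvol)
      obtain ⟨η, h1, h2⟩ := ((hlim.eventually
        (ge_mem_nhds (pos_iff_ne_zero.2 hδ))).and self_mem_nhdsWithin).exists
      exact ⟨η, h2, h1⟩
    filter_upwards [eventually_abs_homothetyAverage_sub_le hkc hks hΩ hν hη,
      Ioo_mem_nhdsLT (show (1 / 2 : ℝ) < 1 by norm_num)] with t htη ht
    have ht0 : 0 < t := lt_trans (by norm_num) ht.1
    have hsplit : (fun x => homothetyAverage ν t g x - g x) =ᵐ[volume.restrict Ω]
        homothetyAverage ν t (g - k) +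
          ((fun x => homothetyAverage ν t k x - k x) + fun x => k x - g x) := by
      refine ae_restrict_of_ae ?_
      filter_upwards [(integrable_comp_homothety (ν := ν) hgm hg ht0).prod_right_ae,
        (integrable_comp_homothety (ν := ν) hkc.measurable hki ht0).prod_right_ae]
        with x hx1 hx2
      have hlin : homothetyAverage ν t (g - k) x =
          homothetyAverage ν t g x - homothetyAverage ν t k x :=
        integral_sub hx1 hx2
      simp only [Pi.add_apply, hlin]
      ring
    have hm1 := (stronglyMeasurable_homothetyAverage (ν := ν) (t := t)
      (hgm.sub hkc.measurable)).aestronglyMeasurable (μ := volume.restrict Ω)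
    have hm2 := ((stronglyMeasurable_homothetyAverage (ν := ν) (t := t) hkc.measurable).sub
      hkc.measurable.stronglyMeasurable).aestronglyMeasurable (μ := volume.restrict Ω)
    have hm3 := (hkc.measurable.sub hgm).aestronglyMeasurable (μ := volume.restrict Ω)
    have e1 : eLpNorm (homothetyAverage ν t (g - k)) p (volume.restrict Ω) ≤ C * δ :=
      (eLpNorm_mono_measure _ Measure.restrict_le_self).trans
        ((eLpNorm_homothetyAverage_le (hgm.sub hkc.measurable) hp hp_top ht).trans (by gcongr))
    have e2 : eLpNorm (fun x => homothetyAverage ν t k x - k x) p (volume.restrict Ω) ≤ δ :=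
      (eLpNorm_le_of_ae_bound ((ae_restrict_iff' hΩm).2 (ae_of_all _ htη))).trans hηδ
    have e3 : eLpNorm (fun x => k x - g x) p (volume.restrict Ω) ≤ δ := by
      refine (eLpNorm_mono_measure _ Measure.restrict_le_self).trans ?_
      exact (eLpNorm_sub_comm k g p volume).trans_le hkδ
    rw [eLpNorm_congr_ae hsplit]
    calc _ ≤ C * δ + (δ + δ) :=
          (eLpNorm_add_le hm1 (hm2.add hm3) hp).trans
            (add_le_add e1 ((eLpNorm_add_le hm2 hm3 hp).trans (add_le_add e2 e3)))
      _ = (C + 2) * δ := by ring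
  rw [ENNReal.tendsto_nhds_zero]
  intro ε hε
  have hC2 : C + 2 ≠ 0 := by simp
  have hC2' : C + 2 ≠ ⊤ := by finiteness
  filter_upwards [main (ε / (C + 2)) (ENNReal.div_pos hε.ne' hC2').ne'] with t ht
  rwa [ENNReal.mul_div_cancel hC2 hC2'] at ht

/-- On a bounded open convex set, a function of bounded variation in `L^p` is approximated in
`L^p` by smooth functions whose total variation is not much larger. -/
theorem exists_contDiff_approx {f : EuclideanSpace ℝ (Fin d) → ℝ} (hΩo : IsOpen Ω)
    (hΩn : Ω.Nonempty) (hΩc : Convex ℝ Ω) (hΩb : Bornology.IsBounded Ω) (hp : 1 ≤ p)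
    (hp_top : p ≠ ⊤) (hf : IntegrableOn f Ω) (hfp : MemLp f p (volume.restrict Ω)) {V : ℝ}
    (hV : totalVar Ω f ≤ V) {ε : ℝ} (hε : 0 < ε) :
    ∃ u : EuclideanSpace ℝ (Fin d) → ℝ, ContDiff ℝ 2 u ∧
      eLpNorm (fun x => u x - f x) p (volume.restrict Ω) ≤ ENNReal.ofReal ε ∧
      totalVar Ω u ≤ ((V + ε : ℝ) : EReal) := by
  obtain ⟨x₀, hx₀⟩ := hΩn
  obtain ⟨R, hR, hball⟩ := Metric.isOpen_iff.1 hΩo x₀ hx₀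
  let b : ContDiffBump x₀ := ⟨R / 4, R / 2, by positivity, by linarith⟩
  set φ := b.normed (volume : Measure (EuclideanSpace ℝ (Fin d))) with hφ
  have hφ0 : ∀ x, 0 ≤ φ x := b.nonneg_normed
  set ν := (volume : Measure (EuclideanSpace ℝ (Fin d))).withDensity
    fun x => ENNReal.ofReal (φ x) with hνdef
  have hprob : IsProbabilityMeasure ν := ⟨by
    rw [hνdef, withDensity_apply _ MeasurableSet.univ, Measure.restrict_univ,
      ← ofReal_integral_eq_lintegral_ofReal b.integrable_normed (ae_of_all _ hφ0),
      b.integral_normed, ENNReal.ofReal_one]⟩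
  have hν : ∀ᵐ z ∂ν, z ∈ Ω := by
    rw [hνdef, ae_withDensity_iff b.continuous_normed.measurable.ennreal_ofReal]
    refine ae_of_all _ fun z hz => hball ?_
    have hz' : z ∈ Function.support φ := fun h => hz (by simpa using h.le)
    rw [hφ, b.support_normed_eq] at hz'
    exact Metric.ball_subset_ball (by change R / 2 ≤ R; linarith) hz'
  -- A measurable representative of `f`, extended by zero.
  set g : EuclideanSpace ℝ (Fin d) → ℝ := Ω.indicator (hf.aestronglyMeasurable.mk f) with hgdef
  have hgf : f =ᵐ[volume.restrict Ω] g := by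
    filter_upwards [hf.aestronglyMeasurable.ae_eq_mk, ae_restrict_mem hΩo.measurableSet]
      with x h1 h2
    rw [hgdef, indicator_of_mem h2, h1]
  have hmk : hf.aestronglyMeasurable.mk f =ᵐ[volume.restrict Ω] f :=
    hf.aestronglyMeasurable.ae_eq_mk.symm
  have hgm : Measurable g :=
    hf.aestronglyMeasurable.stronglyMeasurable_mk.measurable.indicator hΩo.measurableSet
  have hgi : Integrable g :=
    (integrable_indicator_iff hΩo.measurableSet).2 (hf.congr hmk.symm)
  have hgp : MemLp g p volume :=
    (memLp_indicator_iff_restrict hΩo.measurableSet).2 (hfp.ae_eq hmk.symm)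
  have hgV : totalVar Ω g ≤ V := (totalVar_congr_ae hgf).symm.trans_le hV
  have hlim := tendsto_eLpNorm_homothetyAverage_sub hgm hgi hgp hp hp_top hΩo.measurableSet
    hΩb hν
  have hfac : ∀ᶠ t in 𝓝[<] (1 : ℝ), (t ^ d)⁻¹ * t * V < V + ε := by
    have hcont : ContinuousAt (fun t : ℝ => (t ^ d)⁻¹ * t * V) 1 := by
      have : ContinuousAt (fun t : ℝ => (t ^ d)⁻¹) 1 :=
        (continuousAt_id.pow d).inv₀ (by simp)
      fun_prop
    have hlim' : Tendsto (fun t : ℝ => (t ^ d)⁻¹ * t * V) (𝓝 1) (𝓝 V) := by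
      simpa using hcont.tendsto
    exact (hlim'.mono_left nhdsWithin_le_nhds).eventually (gt_mem_nhds (by linarith))
  obtain ⟨t, ⟨ht1, ht2⟩, ht3⟩ := ((hlim.eventually
    (ge_mem_nhds (ENNReal.ofReal_pos.2 hε))).and hfac |>.and
      (Ioo_mem_nhdsLT (zero_lt_one (α := ℝ)))).exists
  refine ⟨homothetyAverage ν t g, contDiff_homothetyAverage b.contDiff_normed
    b.hasCompactSupport_normed hφ0 hgi ht3, ?_, ?_⟩
  · refine (eLpNorm_congr_ae ?_).trans_le ht1
    filter_upwards [hgf] with x hx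
    rw [hx]
  · exact (totalVar_homothetyAverage_le hΩc hν hgm hgi ht3 hgV).trans
      (EReal.coe_le_coe_iff.2 ht2.le)

end HomothetyAverage

/-! ### Choice of the approximations -/

section Choice

variable {d : ℕ} {Ω : Set (EuclideanSpace ℝ (Fin d))}

theorem integrableOn_of_mem_p1Space {v : EuclideanSpace ℝ (Fin d) → ℝ}
    {T : Geometry.SimplicialComplex ℝ (EuclideanSpace ℝ (Fin d))}
    (hΩ : IsConvexPolygonalDomain Ω) (hv : v ∈ p1Space Ω T) : IntegrableOn v Ω :=
  (hv.1.integrableOn_compact hΩ.isCompact_closure).mono_set subset_closure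

theorem zero_mem_p1Space (T : Geometry.SimplicialComplex ℝ (EuclideanSpace ℝ (Fin d))) :
    0 ∈ p1Space Ω T :=
  ⟨continuousOn_const, fun _ _ => ⟨0, fun _ _ => rfl⟩⟩

/-- For fixed accuracy `ε`, interpolating a smooth approximation of `f` works for all small `h`. -/
theorem eventually_exists_p1_approx (hΩ : IsConvexPolygonalDomain Ω)
    {T : ℝ → Geometry.SimplicialComplex ℝ (EuclideanSpace ℝ (Fin d))}
    (hT : IsRegularFamily Ω T) {p : ENNReal} (hp : 1 ≤ p) (hp_top : p ≠ ⊤)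
    {f : EuclideanSpace ℝ (Fin d) → ℝ} (hf : IntegrableOn f Ω)
    (hfp : MemLp f p (volume.restrict Ω)) {V : ℝ} (hV : totalVar Ω f ≤ V) {ε : ℝ} (hε : 0 < ε) :
    ∀ᶠ h in 𝓝[>] (0 : ℝ), ∃ v ∈ p1Space Ω (T h),
      eLpNorm (fun x => v x - f x) p (volume.restrict Ω) ≤ ENNReal.ofReal ε ∧
      totalVar Ω v ≤ ((V + ε : ℝ) : EReal) := by
  have hΩb : Bornology.IsBounded Ω := hΩ.isCompact_closure.isBounded.subset subset_closure
  have hvol : volume Ω ≠ ⊤ := hΩb.measure_lt_top.ne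
  obtain ⟨u, hu, huf, huV⟩ := exists_contDiff_approx hΩ.isOpen hΩ.nonempty hΩ.convex hΩb hp hp_top
    hf hfp hV (half_pos hε)
  obtain ⟨C, hC⟩ := hT.exists_interpolant_error_le hΩ hu
  have hui : IntegrableOn u Ω :=
    (hu.continuous.continuousOn.integrableOn_compact hΩ.isCompact_closure).mono_set subset_closure
  have hsmallTV : ∀ᶠ h in 𝓝[>] (0 : ℝ), d * (C * h * volume.real Ω) < ε / 2 := by
    have hcont : Tendsto (fun h : ℝ => d * (C * h * volume.real Ω)) (𝓝 0) (𝓝 0) := by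
      have : Continuous fun h : ℝ => d * (C * h * volume.real Ω) := by fun_prop
      simpa using this.tendsto 0
    exact (hcont.mono_left nhdsWithin_le_nhds).eventually (gt_mem_nhds (half_pos hε))
  have hsmallLp : ∀ᶠ h in 𝓝[>] (0 : ℝ),
      volume.restrict Ω univ ^ p.toReal⁻¹ * ENNReal.ofReal (C * h) < ENNReal.ofReal (ε / 2) := by
    have hvol' : volume.restrict Ω univ ^ p.toReal⁻¹ ≠ ⊤ := by
      rw [Measure.restrict_apply_univ]
      exact ENNReal.rpow_ne_top_of_nonneg (by positivity) hvol
    have h0 : Tendsto (fun h : ℝ => ENNReal.ofReal (C * h)) (𝓝 0) (𝓝 0) := by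
      have : Continuous fun h : ℝ => ENNReal.ofReal (C * h) :=
        ENNReal.continuous_ofReal.comp (by fun_prop)
      simpa using this.tendsto 0
    have h1 : Tendsto (fun h : ℝ => volume.restrict Ω univ ^ p.toReal⁻¹ * ENNReal.ofReal (C * h))
        (𝓝 0) (𝓝 0) := by
      simpa using ENNReal.Tendsto.const_mul h0 (Or.inr hvol')
    exact (h1.mono_left nhdsWithin_le_nhds).eventually
      (gt_mem_nhds (ENNReal.ofReal_pos.2 (half_pos hε)))
  filter_upwards [hsmallTV, hsmallLp, Ioo_mem_nhdsGT (zero_lt_one (α := ℝ))] with h h1 h2 hh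
  obtain ⟨v, hv, hlip, hsup⟩ := hC h hh
  have hvi := integrableOn_of_mem_p1Space hΩ hv
  refine ⟨v, hv, ?_, ?_⟩
  · have hvu : eLpNorm (fun x => v x - u x) p (volume.restrict Ω) ≤ ENNReal.ofReal (ε / 2) :=
      (eLpNorm_le_of_ae_bound ((ae_restrict_iff' hΩ.isOpen.measurableSet).2
        (ae_of_all _ fun x hx => hsup x (subset_closure hx)))).trans h2.le
    have hsplit : (fun x => v x - f x) = (fun x => v x - u x) + fun x => u x - f x := by
      ext x
      simp
    rw [hsplit]
    calc _ ≤ ENNReal.ofReal (ε / 2) + ENNReal.ofReal (ε / 2) :=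
          (eLpNorm_add_le (hvi.sub hui).aestronglyMeasurable
            (hui.sub hf).aestronglyMeasurable hp).trans (add_le_add hvu huf)
      _ = ENNReal.ofReal ε := by
          rw [← ENNReal.ofReal_add (half_pos hε).le (half_pos hε).le, add_halves]
  · have hTV : totalVar Ω (fun x => v x - u x) ≤ ((ε / 2 : ℝ) : EReal) := by
      refine (totalVar_le_of_lipschitzOnWith hvol hΩ.isOpen.measurableSet
        (hlip.mono subset_closure)).trans (EReal.coe_le_coe_iff.2 ?_)
      rw [NNReal.coe_mul, Real.coe_toNNReal _ hh.1.le]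
      exact h1.le
    have hadd := totalVar_add_le hui (hvi.sub hui) huV hTV
    have hfun : (fun x => u x + (v - u) x) = v := by
      ext x
      simp
    rw [hfun, add_assoc, add_halves] at hadd
    exact hadd

/-- Diagonal selection: if for every accuracy `ε > 0` a good element exists for all small `h`, then
there is a choice of elements whose accuracy tends to `0` with `h`. -/
theorem exists_selection_of_eventually {α : Type*} {S : ℝ → Set α} {P : ℝ → α → Prop}
    (hmono : ∀ ⦃ε ε'⦄, ε ≤ ε' → ∀ v, P ε v → P ε' v)
    (hne : ∀ h, (S h).Nonempty)
    (hex : ∀ ε, 0 < ε → ∀ᶠ h in 𝓝[>] (0 : ℝ), ∃ v ∈ S h, P ε v) :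
    ∃ F : ℝ → α, (∀ h, F h ∈ S h) ∧ ∀ ε, 0 < ε → ∀ᶠ h in 𝓝[>] (0 : ℝ), P ε (F h) := by
  classical
  -- `m h` is the best accuracy available at `h`; the choice attains it up to `h`.
  set A : ℝ → Set ℝ := fun h => {ε | 0 < ε ∧ ∃ v ∈ S h, P ε v} with hA
  set m : ℝ → ℝ := fun h => sInf (A h) with hm
  have hbdd : ∀ h, BddBelow (A h) := fun h => ⟨0, fun ε hε => hε.1.le⟩
  have hchoice : ∀ h, ∃ v ∈ S h, (0 < h → (A h).Nonempty → P (m h + h) v) := by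
    intro h
    by_cases hc : 0 < h ∧ (A h).Nonempty
    · obtain ⟨ε, hε, hlt⟩ := exists_lt_of_csInf_lt hc.2 (lt_add_of_pos_right (m h) hc.1)
      obtain ⟨-, v, hv, hP⟩ := hε
      exact ⟨v, hv, fun _ _ => hmono hlt.le v hP⟩
    · obtain ⟨v, hv⟩ := hne h
      exact ⟨v, hv, fun h1 h2 => absurd ⟨h1, h2⟩ hc⟩
  choose F hF hFP using hchoice
  refine ⟨F, hF, fun ε hε => ?_⟩
  filter_upwards [hex (ε / 2) (half_pos hε), Ioo_mem_nhdsGT (half_pos hε)] with h hh hh'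
  have hmem : ε / 2 ∈ A h := ⟨half_pos hε, hh⟩
  have hmle : m h ≤ ε / 2 := csInf_le (hbdd h) hmem
  exact hmono (by linarith [hh'.2]) _ (hFP h hh'.1 ⟨_, hmem⟩)

end Choice

theorem mainTheorem7 {d : ℕ} (hd : d = 1 ∨ d = 2)
    (Ω : Set (EuclideanSpace ℝ (Fin d))) (hΩ : IsConvexPolygonalDomain Ω)
    (T : ℝ → Geometry.SimplicialComplex ℝ (EuclideanSpace ℝ (Fin d)))
    (hT : IsRegularFamily Ω T)
    (p : ENNReal) (hp : 1 ≤ p) (hp_top : p ≠ ⊤)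
    (f : EuclideanSpace ℝ (Fin d) → ℝ) (hf : IsBV Ω f)
    (hfp : MemLp f p (volume.restrict Ω)) :
    ∃ fhat : ℝ → EuclideanSpace ℝ (Fin d) → ℝ,
      (∀ h ∈ Ioo (0 : ℝ) 1, fhat h ∈ p1Space Ω (T h)) ∧
      Tendsto (fun h => eLpNorm (fun x => fhat h x - f x) p (volume.restrict Ω))
        (𝓝[>] (0 : ℝ)) (𝓝 0) ∧
      Tendsto (fun h => totalVar Ω (fhat h)) (𝓝[>] (0 : ℝ)) (𝓝 (totalVar Ω f)) := by
  obtain ⟨hfi, hftop⟩ := hf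
  obtain ⟨V, hV⟩ : ∃ V : ℝ, totalVar Ω f = V :=
    ⟨(totalVar Ω f).toReal, (EReal.coe_toReal hftop.ne
      (ne_bot_of_le_ne_bot EReal.zero_ne_bot totalVar_nonneg)).symm⟩
  obtain ⟨F, hF, hFε⟩ := exists_selection_of_eventually (S := fun h => p1Space Ω (T h))
    (P := fun ε v => eLpNorm (fun x => v x - f x) p (volume.restrict Ω) ≤ ENNReal.ofReal ε ∧
      totalVar Ω v ≤ ((V + ε : ℝ) : EReal))
    (fun ε ε' hεε' v hv => ⟨hv.1.trans (ENNReal.ofReal_le_ofReal hεε'),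
      hv.2.trans (EReal.coe_le_coe_iff.2 (by linarith))⟩)
    (fun h => ⟨0, zero_mem_p1Space (T h)⟩)
    (fun ε hε => eventually_exists_p1_approx hΩ hT hp hp_top hfi hfp hV.le hε)
  have hFi : ∀ h, IntegrableOn (F h) Ω := fun h => integrableOn_of_mem_p1Space hΩ (hF h)
  have hLp : Tendsto (fun h => eLpNorm (fun x => F h x - f x) p (volume.restrict Ω))
      (𝓝[>] (0 : ℝ)) (𝓝 0) := by
    rw [ENNReal.tendsto_nhds_zero]
    intro ε hε
    obtain ⟨δ, hδ, hδε⟩ : ∃ δ : ℝ, 0 < δ ∧ ENNReal.ofReal δ ≤ ε := by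
      obtain ⟨δ, hδ, hδε⟩ := ENNReal.lt_iff_exists_nnreal_btwn.1 hε
      exact ⟨δ, by exact_mod_cast hδ, by simpa using hδε.le⟩
    exact (hFε δ hδ).mono fun h hh => hh.1.trans hδε
  refine ⟨F, fun h _ => hF h, hLp, ?_⟩
  have hvol : volume Ω ≠ ⊤ :=
    (hΩ.isCompact_closure.isBounded.subset subset_closure).measure_lt_top.ne
  have hL1 : Tendsto (fun h => eLpNorm (fun x => F h x - f x) 1 (volume.restrict Ω))
      (𝓝[>] (0 : ℝ)) (𝓝 0) := by
    set c := volume.restrict Ω univ ^ (1 / (1 : ENNReal).toReal - 1 / p.toReal) with hc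
    have hctop : c ≠ ⊤ := by
      have hp1 : 1 ≤ p.toReal := by
        simpa using ENNReal.toReal_mono hp_top hp
      rw [hc, Measure.restrict_apply_univ]
      refine ENNReal.rpow_ne_top_of_nonneg ?_ hvol
      rw [ENNReal.toReal_one, one_div_one, sub_nonneg, div_le_one (by linarith)]
      exact hp1
    have h0 : Tendsto (fun h => eLpNorm (fun x => F h x - f x) p (volume.restrict Ω) * c)
        (𝓝[>] (0 : ℝ)) (𝓝 0) := by
      simpa using ENNReal.Tendsto.mul_const hLp (Or.inr hctop)
    exact tendsto_of_tendsto_of_tendsto_of_le_of_le tendsto_const_nhds h0 (fun _ => zero_le)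
      fun h => eLpNorm_le_eLpNorm_mul_rpow_measure_univ hp ((hFi h).sub hfi).aestronglyMeasurable
  refine tendsto_order.2 ⟨fun c hc =>
    eventually_lt_totalVar hfi (Eventually.of_forall hFi) hL1 hc, fun c hc => ?_⟩
  rw [hV] at hc
  obtain ⟨q, hq, hqc⟩ := EReal.lt_iff_exists_real_btwn.1 hc
  rw [EReal.coe_lt_coe_iff] at hq
  filter_upwards [hFε (q - V) (sub_pos.2 hq)] with h hh
  have hle := hh.2
  rw [add_sub_cancel] at hle
  exact hle.trans_lt hqc
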